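/- Let $p$ be a prime and let $R$ be an $F$-finite Noetherian normal domain of characteristic $p$. Let $\Delta$ be an effective $\mathbb{Q}$-divisor on $\operatorname{Spec} R$, let $\mathfrak{a} \neq (0)$ be an ideal of $R$, and let $t > 0$ be a real number. For an effective integral divisor $D$ write $R(D)$ for the global sections of $\mathcal{O}(D)$ on $\operatorname{Spec} R$. For each integer $e \geq 0$ let $$\pi_{\Delta,e} : \operatorname{Hom}_R\big((R(\lceil (p^e-1)\Delta\rceil))^{1/p^e}, R\big) \to \operatorname{Hom}_R(R^{1/p^e}, R)$$ be the map induced by the inclusion $R \subseteq R(\lceil (p^e-1)\Delta\rceil)$. The triple $(R, \Delta, \mathfrak{a}^t)$ is called *locally strongly $F$-regular* if for every $0 \neq d \in R$ there are an integer $e > 0$ and a surjective map $\phi : R^{1/p^e} \to R$ in $\operatorname{Im}(\pi_{\Delta,e}) \cdot \big(d\,\mathfrak{a}^{\lceil t(p^e-1)\rceil}\big)^{1/p^e}$, the $R^{1/p^e}$-submodule of $\operatorname{Hom}_R(R^{1/p^e}, R)$ consisting of all finite sums of maps $\psi(y^{1/p^e}\,\cdot\,)$ with $\psi \in \operatorname{Im}(\pi_{\Delta,e})$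 and $y \in d\,\mathfrak{a}^{\lceil t(p^e-1)\rceil}$. The *big test ideal* $\tau_b(R; \Delta, \mathfrak{a}^t)$ is the smallest nonzero ideal $J$ of $R$ (equivalently, the intersection of all nonzero ideals $J$) such that $\phi\big((\mathfrak{a}^{\lceil t(p^e-1)\rceil} J)^{1/p^e}\big) \subseteq J$ for all $e \geq 0$ and all $\phi \in \operatorname{Im}(\pi_{\Delta,e})$. Then $\tau_b(R; \Delta, \mathfrak{a}^t) = R$ if and only if the triple $(R, \Delta, \mathfrak{a}^t)$ is locally strongly $F$-regular. -/

import Mathlib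

open IsDedekindDomain

noncomputable section

namespace FSing

/-! ### Weil divisors on `Spec R`, for a Noetherian normal domain `R` -/

/-- A prime ideal of height one, i.e. a prime divisor on `Spec R`. -/
structure HeightOnePrime (R : Type*) [CommRing R] where
  asIdeal : Ideal R
  isPrime : asIdeal.IsPrime
  height_eq_one : asIdeal.height = 1

/-- `ℤ`-divisors on `Spec R`. -/
abbrev WeilDivisor (R : Type*) [CommRing R] := HeightOnePrime R →₀ ℤ

/-- `ℚ`-divisors on `Spec R`. -/
abbrev QDivisor (R : Type*) [CommRing R] := HeightOnePrime R →₀ ℚ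

/-- The round-up `⌈Δ⌉`, coefficient by coefficient. -/
def QDivisor.ceil {R : Type*} [CommRing R] (Δ : QDivisor R) : WeilDivisor R :=
  Δ.mapRange Int.ceil Int.ceil_zero

/-- The divisor `⌈(p ^ e - 1) Δ⌉`. -/
def ceilDivisor {R : Type*} [CommRing R] (p e : ℕ) (Δ : QDivisor R) : WeilDivisor R :=
  QDivisor.ceil (((p : ℚ) ^ e - 1) • Δ)

theorem ceilDivisor_nonneg {R : Type*} [CommRing R] (p : ℕ) [hp : Fact p.Prime] (e : ℕ)
    {Δ : QDivisor R} (hΔ : 0 ≤ Δ) : 0 ≤ ceilDivisor p e Δ := by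
  intro P
  have h1 : (1 : ℚ) ≤ (p : ℚ) ^ e := one_le_pow₀ (by exact_mod_cast hp.out.one_le)
  have h2 : 0 ≤ Δ P := hΔ P
  simp only [ceilDivisor, QDivisor.ceil, Finsupp.mapRange_apply, Finsupp.smul_apply,
    Finsupp.coe_zero, Pi.zero_apply, smul_eq_mul]
  exact Int.ceil_nonneg (mul_nonneg (by linarith) h2)

section Sections

variable {R : Type*} [CommRing R] [IsDomain R] [IsNoetherianRing R] [IsIntegrallyClosed R]

instance (P : HeightOnePrime R) : P.asIdeal.IsPrime := P.isPrime

/-- A Noetherian normal domain is a discrete valuation ring at its height one primes. -/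
instance isDiscreteValuationRing_atPrime (P : HeightOnePrime R) :
    IsDiscreteValuationRing (Localization.AtPrime P.asIdeal) := by
  have hdim : ringKrullDim (Localization.AtPrime P.asIdeal) = 1 := by
    rw [IsLocalization.AtPrime.ringKrullDim_eq_height P.asIdeal, P.height_eq_one]; rfl
  have hle : P.asIdeal.primeCompl ≤ nonZeroDivisors R := P.asIdeal.primeCompl_le_nonZeroDivisors
  have hnf : ¬ IsField (Localization.AtPrime P.asIdeal) := fun h => by
    have := ringKrullDim_eq_zero_of_isField h
    rw [hdim] at this
    exact one_ne_zero this
  have hic : IsIntegrallyClosed (Localization.AtPrime P.asIdeal) :=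
    isIntegrallyClosed_of_isLocalization _ P.asIdeal.primeCompl hle
  have hk : Ring.KrullDimLE 1 (Localization.AtPrime P.asIdeal) :=
    Ring.krullDimLE_iff.mpr hdim.le
  have hm : ∀ Q : Ideal (Localization.AtPrime P.asIdeal), Q ≠ ⊥ → Q.IsPrime → Q.IsMaximal :=
    fun Q h0 hQ => Ring.krullDimLE_one_iff_of_isPrime_bot.mp hk Q h0 hQ
  have hd : IsDedekindDomain (Localization.AtPrime P.asIdeal) :=
    { hic with
      toIsDomain := inferInstance
      toIsNoetherian := inferInstance
      maximalOfPrime := fun {Q} h0 hQ => hm Q h0 hQ }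
  exact ((IsDiscreteValuationRing.TFAE _ hnf).out 0 2).mpr hd

/-- The multiplicatively written valuation of the function field along the prime divisor `P`:
a uniformizer of `R_P` has value `exp (-1)`, so `v_P f = exp (- ord_P f)` for `f ≠ 0`. -/
def divisorValuation (P : HeightOnePrime R) :
    Valuation (FractionRing R) (WithZero (Multiplicative ℤ)) :=
  (IsDiscreteValuationRing.maximalIdeal (Localization.AtPrime P.asIdeal)).valuation
    (FractionRing R)

theorem divisorValuation_algebraMap_le_one (P : HeightOnePrime R) (r : R) :
    divisorValuation P (algebraMap R (FractionRing R) r) ≤ 1 := by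
  rw [IsScalarTower.algebraMap_apply R (Localization.AtPrime P.asIdeal) (FractionRing R)]
  exact HeightOneSpectrum.valuation_le_one _ _

/-- `R(D)`, the global sections of `𝒪(D)`: all `f` in the fraction field with `f = 0` or
`ord_P f + D(P) ≥ 0` for all prime divisors `P`. -/
def divisorSections (D : WeilDivisor R) : Submodule R (FractionRing R) where
  carrier := {f | ∀ P : HeightOnePrime R, divisorValuation P f ≤ WithZero.exp (D P)}
  add_mem' := fun ha hb P => (Valuation.map_add _ _ _).trans (max_le (ha P) (hb P))
  zero_mem' := fun P => by simp
  smul_mem' := fun r f hf P => by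
    rw [Algebra.smul_def, map_mul]
    exact (mul_le_mul' (divisorValuation_algebraMap_le_one P r) (hf P)).trans (one_mul _).le

/-- The natural inclusion `R → R(D)` for an effective divisor `D`. -/
def toDivisorSections (D : WeilDivisor R) (hD : 0 ≤ D) : R →ₗ[R] divisorSections D :=
  (Algebra.linearMap R (FractionRing R)).codRestrict (divisorSections D) fun r P =>
    (divisorValuation_algebraMap_le_one P r).trans (by
      rw [← WithZero.exp_zero, WithZero.exp_le_exp]; exact hD P)

end Sections

/-! ### The modules `M^{1/p^e}` -/

/-- `M^{1/p^e}`: the abelian group `M`, on which `R` acts through the `e`-th power of Frobenius.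
The element `x : M` stands for `x^{1/p^e}`. For `M = R` reduced this is `R^{1/p^e}` with its
natural structure of an `R`-module. -/
def FrobRoot (_p _e : ℕ) (M : Type*) : Type _ := M

namespace FrobRoot

instance (p e : ℕ) (M : Type*) [AddCommGroup M] : AddCommGroup (FrobRoot p e M) :=
  inferInstanceAs (AddCommGroup M)

/-- The bijection `x ↦ x^{1/p^e}`. -/
def root (p e : ℕ) {M : Type*} [AddCommGroup M] : M ≃+ FrobRoot p e M := AddEquiv.refl M

variable {R : Type*} [CommRing R] (p e : ℕ) [ExpChar R p]

instance (M : Type*) [AddCommGroup M] [Module R M] : Module R (FrobRoot p e M) :=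
  Module.compHom M (iterateFrobenius R p e)

/-- `r • x^{1/p^e} = (r ^ (p ^ e) • x)^{1/p^e}`. -/
theorem smul_root {M : Type*} [AddCommGroup M] [Module R M] (r : R) (x : M) :
    r • root p e x = root p e (r ^ p ^ e • x) := rfl

/-- The `R`-linear map `f^{1/p^e} : M^{1/p^e} → N^{1/p^e}`, `x^{1/p^e} ↦ (f x)^{1/p^e}`. -/
def map {M N : Type*} [AddCommGroup M] [Module R M] [AddCommGroup N] [Module R N]
    (f : M →ₗ[R] N) : FrobRoot p e M →ₗ[R] FrobRoot p e N where
  toFun x := root p e (f ((root p e).symm x))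
  map_add' x y := by simp
  map_smul' r x := f.map_smul (r ^ p ^ e) ((root p e).symm x)

/-- Multiplication by `y^{1/p^e}` on `R^{1/p^e}`. -/
def mulRoot (y : R) : FrobRoot p e R →ₗ[R] FrobRoot p e R := map p e (LinearMap.mulLeft R y)

end FrobRoot

/-- `N · J^{1/p^e}` for a submodule `N` of `Hom(R^{1/p^e}, R)` and an ideal `J`: all finite sums
of maps `ψ(y^{1/p^e} · _)` with `ψ ∈ N` and `y ∈ J`. -/
def mulRootIdeal {R : Type*} [CommRing R] {p e : ℕ} [ExpChar R p]
    (N : Submodule R (FrobRoot p e R →ₗ[R] R)) (J : Ideal R) :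
    Submodule R (FrobRoot p e R →ₗ[R] R) :=
  Submodule.span R {φ | ∃ ψ ∈ N, ∃ y ∈ J, φ = ψ ∘ₗ FrobRoot.mulRoot p e y}

/-- `N · J^{1/p^e}` is an `R^{1/p^e}`-submodule of `Hom(R^{1/p^e}, R)`. -/
theorem comp_mulRoot_mem_mulRootIdeal {R : Type*} [CommRing R] {p e : ℕ} [ExpChar R p]
    (N : Submodule R (FrobRoot p e R →ₗ[R] R)) (J : Ideal R) (z : R)
    {φ : FrobRoot p e R →ₗ[R] R} (hφ : φ ∈ mulRootIdeal N J) :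
    φ ∘ₗ FrobRoot.mulRoot p e z ∈ mulRootIdeal N J := by
  induction hφ using Submodule.span_induction with
  | mem φ h =>
    obtain ⟨ψ, hψ, y, hy, rfl⟩ := h
    refine Submodule.subset_span ⟨ψ, hψ, y * z, J.mul_mem_right z hy, ?_⟩
    ext x
    exact congrArg ψ (mul_assoc y z x).symm
  | zero => simp
  | add φ φ' _ _ h h' => rw [LinearMap.add_comp]; exact add_mem h h'
  | smul r φ _ h => rw [LinearMap.smul_comp]; exact Submodule.smul_mem _ r h

/-- `R` is `F`-finite: `R` is a finite module over itself through Frobenius. -/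
def IsFFinite (R : Type*) [CommRing R] (p : ℕ) [ExpChar R p] : Prop := (frobenius R p).Finite

/-! ### Triples `(R, Δ, 𝔞 ^ t)` -/

section Triples

variable {R : Type*} [CommRing R] [IsDomain R] [IsNoetherianRing R] [IsIntegrallyClosed R]
  (p : ℕ) [Fact p.Prime] [CharP R p]

/-- `π_{Δ,e} : Hom(R(⌈(p^e - 1)Δ⌉)^{1/p^e}, R) → Hom(R^{1/p^e}, R)`, the restriction along the
inclusion of `R` into `R(⌈(p^e - 1)Δ⌉)`. -/
def piMap (e : ℕ) (Δ : QDivisor R) (hΔ : 0 ≤ Δ) :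
    (FrobRoot p e (divisorSections (ceilDivisor p e Δ)) →ₗ[R] R) →ₗ[R]
      (FrobRoot p e R →ₗ[R] R) :=
  LinearMap.lcomp R R
    (FrobRoot.map p e (toDivisorSections (ceilDivisor p e Δ) (ceilDivisor_nonneg p e hΔ)))

/-- The ideal `𝔞 ^ ⌈t (p ^ e - 1)⌉`. -/
def idealPower (𝔞 : Ideal R) (t : ℝ) (e : ℕ) : Ideal R := 𝔞 ^ ⌈t * ((p : ℝ) ^ e - 1)⌉₊

/-- The triple `(R, Δ, 𝔞 ^ t)` is locally strongly `F`-regular. As `R` is a domain, `d ∈ R°`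
means `d ≠ 0`. -/
def IsLocallyStronglyFRegular (Δ : QDivisor R) (hΔ : 0 ≤ Δ) (𝔞 : Ideal R) (t : ℝ) : Prop :=
  ∀ d : R, d ≠ 0 → ∃ e : ℕ, 0 < e ∧
    ∃ φ ∈ mulRootIdeal (LinearMap.range (piMap p e Δ hΔ)) (Ideal.span {d} * idealPower p 𝔞 t e),
      Function.Surjective φ

/-- `φ((𝔞^⌈t(p^e - 1)⌉ J)^{1/p^e}) ⊆ J` for all `e ≥ 0` and all `φ` in the image of `π_{Δ,e}`. -/
def IsUniformlyCompatible (Δ : QDivisor R) (hΔ : 0 ≤ Δ) (𝔞 : Ideal R) (t : ℝ)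
    (J : Ideal R) : Prop :=
  ∀ e : ℕ, ∀ φ ∈ LinearMap.range (piMap p e Δ hΔ), ∀ x ∈ idealPower p 𝔞 t e * J,
    φ (FrobRoot.root p e x) ∈ J

/-- The big test ideal `τ_b(R; Δ, 𝔞 ^ t)`: the smallest nonzero uniformly compatible ideal,
written as the infimum of all of them. -/
def bigTestIdeal (Δ : QDivisor R) (hΔ : 0 ≤ Δ) (𝔞 : Ideal R) (t : ℝ) : Ideal R :=
  sInf {J | J ≠ ⊥ ∧ IsUniformlyCompatible p Δ hΔ 𝔞 t J}

/-- Any smallest nonzero uniformly compatible ideal is the big test ideal. -/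
theorem bigTestIdeal_eq_of_isLeast (Δ : QDivisor R) (hΔ : 0 ≤ Δ) (𝔞 : Ideal R) (t : ℝ)
    {τ : Ideal R} (h : IsLeast {J | J ≠ ⊥ ∧ IsUniformlyCompatible p Δ hΔ 𝔞 t J} τ) :
    bigTestIdeal p Δ hΔ 𝔞 t = τ :=
  h.isGLB.sInf_eq

/-- The big test ideal is `R` exactly if `R` is the smallest nonzero uniformly compatible ideal. -/
theorem bigTestIdeal_eq_top_iff (Δ : QDivisor R) (hΔ : 0 ≤ Δ) (𝔞 : Ideal R) (t : ℝ) :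
    bigTestIdeal p Δ hΔ 𝔞 t = ⊤ ↔
      IsLeast {J | J ≠ ⊥ ∧ IsUniformlyCompatible p Δ hΔ 𝔞 t J} (⊤ : Ideal R) := by
  refine ⟨fun h => ⟨⟨top_ne_bot, fun _ _ _ _ _ => Submodule.mem_top⟩, fun J hJ => ?_⟩,
    bigTestIdeal_eq_of_isLeast p Δ hΔ 𝔞 t⟩
  rw [← h]
  exact sInf_le hJ

end Triples

end FSing

end

namespace FSing

/-! For an ideal `J`, let `T_e(J)` be the trace ideal `traceIdeal` at level `e`. If a nonzero
compatible `J` contains `d ≠ 0`, each map supplied by regularity for `d` has image in `J`, and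
surjectivity gives `J = R`.

Conversely, fix `d ≠ 0` and sum `T_e((d))` over `e ≥ 1`. By `F`-finiteness the sum is nonzero. It is
compatible because `T_f(T_e(J)) ≤ T_{e+f}(J)`, so it is `R` when the test ideal is `R`. To reach a
single level, note that `s ∈ T_e(J)` gives `s^k ∈ T_{ek}(J)` for `k ≥ 1`: a finite set of levels
embeds in the radical of `T_m(J)`, with `m` a common multiple, and an ideal with unit radical is the
unit ideal. Then `1 ∈ T_m((d))` provides a map with value `1` at `1`. No localization at maximal
ideals is needed.

The inclusion for composites rests on `p^(e+f) - 1 = (p^e - 1) + p^e (p^f - 1)` and on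
`exists_twist`, which uses normality through a check in codimension one. -/

theorem HeightOnePrime.ne_bot {R : Type*} [CommRing R] [IsDomain R]
    (P : HeightOnePrime R) : P.asIdeal ≠ ⊥ := fun h => by
  have h1 := P.height_eq_one
  rw [h, Ideal.height_bot] at h1
  exact zero_ne_one h1

/-! ### Height one primes and sections of divisors -/

section Divisors

variable {R : Type*} [CommRing R] [IsDomain R] [IsNoetherianRing R]

/-- A prime minimal over `I` inside `P` is nonzero, so its height is already at least one and it
cannot be strictly smaller than `P`. -/
theorem HeightOnePrime.mem_minimalPrimes (P : HeightOnePrime R) {I : Ideal R} (hI : I ≠ ⊥)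
    (hIP : I ≤ P.asIdeal) : P.asIdeal ∈ I.minimalPrimes := by
  have := P.isPrime
  obtain ⟨q, hq, hqP⟩ := Ideal.exists_minimalPrimes_le hIP
  have := hq.1.1
  have hP : P.asIdeal ∈ q.minimalPrimes := by
    refine Ideal.mem_minimalPrimes_of_height_le hqP ?_
    rw [P.height_eq_one, Order.one_le_iff_ne_zero, Ne, Ideal.height_eq_zero_iff,
      IsDomain.minimalPrimes_eq_singleton_bot]
    exact fun h => hI (le_bot_iff.1 (hq.1.2.trans_eq h))
  rwa [hqP.antisymm (hP.2 ⟨this, le_rfl⟩ hqP)] at hq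

theorem HeightOnePrime.eq_of_le {P Q : HeightOnePrime R} (h : P.asIdeal ≤ Q.asIdeal) : P = Q := by
  have h1 := (Q.mem_minimalPrimes P.ne_bot h).2 ⟨P.isPrime, le_rfl⟩ h
  cases P; cases Q
  congr
  exact le_antisymm h h1

/-- A nonzero element of a Noetherian domain lies in only finitely many height one primes. -/
theorem finite_heightOnePrime_mem {b : R} (hb : b ≠ 0) :
    {P : HeightOnePrime R | b ∈ P.asIdeal}.Finite := by
  refine Set.Finite.of_finite_image (f := HeightOnePrime.asIdeal) ?_
    fun P _ Q _ h => HeightOnePrime.eq_of_le h.le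
  refine (Ideal.finite_minimalPrimes_of_isNoetherianRing R (Ideal.span {b})).subset ?_
  rintro _ ⟨P, hP, rfl⟩
  exact P.mem_minimalPrimes (by simpa using hb) ((Ideal.span_singleton_le_iff_mem _).2 hP)

variable [IsIntegrallyClosed R]

/-- The prime divisors of a nonzero principal ideal in a Noetherian normal domain have
height one. -/
theorem height_eq_one_of_eq_setOf_mul_mem_span {P : Ideal R} [P.IsPrime] {b c : R} (hb : b ≠ 0)
    (hP : ∀ r, r ∈ P ↔ b ∣ r * c) : P.height = 1 := by
  have hbP : b ∈ P := (hP b).2 (dvd_mul_right b c)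
  have hcb : ¬ b ∣ c := fun h =>
    (Ideal.ne_top_iff_one P).1 (Ideal.IsPrime.ne_top ‹_›) ((hP 1).2 (by rwa [one_mul]))
  refine le_antisymm ?_ (Order.one_le_iff_ne_zero.2 fun h => ?_)
  swap
  · rw [Ideal.height_eq_zero_iff, IsDomain.minimalPrimes_eq_singleton_bot] at h
    exact hb (by simpa [Set.mem_singleton_iff.1 h] using hbP)
  let K := FractionRing R
  have hb' : algebraMap R K b ≠ 0 := IsFractionRing.to_map_eq_zero_iff.not.mpr hb
  -- Either multiplication by `c / b` maps `P` into itself, and `c / b` is integral, hence in `R`;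
  -- or some `q ∈ P` has `c q / b = u ∉ P`, and then `q` generates `P` locally, so Krull's principal
  -- ideal theorem applies.
  by_cases hx : ∀ q ∈ P, ∃ u ∈ P, q * c = b * u
  · exfalso
    have hint : IsIntegral R (algebraMap R K c / algebraMap R K b) := by
      refine isIntegral_of_smul_mem_submodule (M := K) (Submodule.map (Algebra.linearMap R K) P) ?_
        (Submodule.FG.map _ (IsNoetherian.noetherian P)) _ ?_
      · exact (Submodule.ne_bot_iff _).2 ⟨_, ⟨b, hbP, rfl⟩, hb'⟩
      · rintro _ ⟨q, hq, rfl⟩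
        obtain ⟨u, hu, h⟩ := hx q hq
        refine ⟨u, hu, ?_⟩
        have h' := congrArg (algebraMap R K) h
        rw [map_mul, map_mul] at h'
        rw [Algebra.linearMap_apply, Algebra.linearMap_apply, smul_eq_mul, div_mul_eq_mul_div,
          eq_div_iff hb', mul_comm, ← h', mul_comm]
    obtain ⟨y, hy⟩ := IsIntegrallyClosed.algebraMap_eq_of_integral hint
    refine hcb ⟨y, IsFractionRing.injective R K ?_⟩
    rw [map_mul, hy, mul_div_cancel₀ _ hb']
  · push Not at hx
    obtain ⟨q, hq, hqu⟩ := hx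
    obtain ⟨u, hu⟩ := (hP q).1 hq
    have huP : u ∉ P := fun h => hqu u h hu
    refine Ideal.height_le_one_of_isPrincipal_of_mem_minimalPrimes (Ideal.span {q}) P
      ⟨⟨‹_›, (Ideal.span_singleton_le_iff_mem _).2 hq⟩, ?_⟩
    rintro Q ⟨hQ, hqQ⟩ hQP r hr
    obtain ⟨w, hw⟩ := (hP r).1 hr
    have hru : r * u = q * w := mul_left_cancel₀ hb (by linear_combination q * hw - r * hu)
    have hmem : r * u ∈ Q := hru ▸ Q.mul_mem_right w ((Ideal.span_singleton_le_iff_mem _).1 hqQ)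
    exact (hQ.mem_or_mem hmem).resolve_right fun h => huP (hQP h)

theorem divisorValuation_algebraMap_lt_one_iff (P : HeightOnePrime R) (r : R) :
    divisorValuation P (algebraMap R (FractionRing R) r) < 1 ↔ r ∈ P.asIdeal := by
  rw [IsScalarTower.algebraMap_apply R (Localization.AtPrime P.asIdeal) (FractionRing R),
    divisorValuation, HeightOneSpectrum.valuation_lt_one_iff_mem]
  exact IsLocalization.AtPrime.to_map_mem_maximal_iff _ P.asIdeal r

theorem divisorValuation_algebraMap_eq_one {P : HeightOnePrime R} {r : R} (hr : r ∉ P.asIdeal) :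
    divisorValuation P (algebraMap R (FractionRing R) r) = 1 :=
  (divisorValuation_algebraMap_le_one P r).antisymm
    (not_lt.1 fun h => hr ((divisorValuation_algebraMap_lt_one_iff P r).1 h))

theorem divisorValuation_algebraMap_le_exp_neg_one {P : HeightOnePrime R} {r : R}
    (hr : r ∈ P.asIdeal) :
    divisorValuation P (algebraMap R (FractionRing R) r) ≤ WithZero.exp (-1) := by
  rw [← WithZero.lt_mul_exp_iff_le WithZero.exp_ne_zero, ← WithZero.exp_add]
  exact (divisorValuation_algebraMap_lt_one_iff P r).2 hr

theorem exists_divisorValuation_eq_exp_neg_one (P : HeightOnePrime R) :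
    ∃ q : R, divisorValuation P (algebraMap R (FractionRing R) q) = WithZero.exp (-1) := by
  obtain ⟨π, hπ⟩ := (IsDiscreteValuationRing.maximalIdeal
    (Localization.AtPrime P.asIdeal)).intValuation_exists_uniformizer
  obtain ⟨⟨q, s⟩, hs⟩ := IsLocalization.surj P.asIdeal.primeCompl π
  refine ⟨q, ?_⟩
  have h := congrArg (fun z => divisorValuation P
    (algebraMap (Localization.AtPrime P.asIdeal) (FractionRing R) z)) hs
  simp only [map_mul, ← IsScalarTower.algebraMap_apply,
    divisorValuation_algebraMap_eq_one s.2, mul_one] at h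
  rw [← h, divisorValuation, HeightOneSpectrum.valuation_of_algebraMap, hπ]

theorem exists_notMem_mul_eq_of_divisorValuation_le_one (P : HeightOnePrime R)
    {x : FractionRing R} (hx : divisorValuation P x ≤ 1) :
    ∃ u : R, ∃ s ∉ P.asIdeal,
      algebraMap R (FractionRing R) s * x = algebraMap R (FractionRing R) u := by
  obtain ⟨y, rfl⟩ := IsDiscreteValuationRing.exists_lift_of_le_one hx
  obtain ⟨⟨u, s⟩, hs⟩ := IsLocalization.surj P.asIdeal.primeCompl y
  refine ⟨u, s, s.2, ?_⟩
  have h := congrArg (algebraMap (Localization.AtPrime P.asIdeal) (FractionRing R)) hs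
  simp only [map_mul, ← IsScalarTower.algebraMap_apply] at h
  rw [← h, mul_comm]

/-- Elements of `K` without poles in codimension one belong to the Noetherian normal
domain `R`. -/
theorem exists_algebraMap_eq_of_divisorValuation_le_one {x : FractionRing R}
    (hx : ∀ P : HeightOnePrime R, divisorValuation P x ≤ 1) :
    ∃ r : R, algebraMap R (FractionRing R) r = x := by
  obtain ⟨a, b, hb, rfl⟩ := IsFractionRing.div_surjective (A := R) x
  have hb0 : b ≠ 0 := nonZeroDivisors.ne_zero hb
  have hb' : algebraMap R (FractionRing R) b ≠ 0 := IsFractionRing.to_map_eq_zero_iff.not.mpr hb0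
  suffices h : b ∣ a by
    obtain ⟨r, rfl⟩ := h
    exact ⟨r, by rw [map_mul, mul_div_cancel_left₀ _ hb']⟩
  by_contra hba
  -- If `b ∤ a`, the annihilator of `a` modulo `b` lies in an associated prime `P` of `R/(b)`, which
  -- has height one. Writing `a / b = u / s` with `s ∉ P` puts `s` in that annihilator, a
  -- contradiction.
  have ha : (Ideal.Quotient.mk (Ideal.span {b}) a) ≠ 0 := fun h =>
    hba (Ideal.mem_span_singleton.1 (Ideal.Quotient.eq_zero_iff_mem.1 h))
  obtain ⟨P, hP, hle⟩ := exists_le_isAssociatedPrime_of_isNoetherianRing R _ ha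
  obtain ⟨hprime, z, hz⟩ := isAssociatedPrime_iff.1 hP
  obtain ⟨c, rfl⟩ := Ideal.Quotient.mk_surjective z
  have hcolon : ∀ r y : R, r ∈ (⊥ : Submodule R (R ⧸ Ideal.span {b})).colon
      {Ideal.Quotient.mk (Ideal.span {b}) y} ↔ b ∣ r * y := fun r y => by
    rw [Submodule.mem_colon_singleton, Submodule.mem_bot, ← Ideal.mem_span_singleton,
      ← Ideal.Quotient.eq_zero_iff_mem, map_mul, Algebra.smul_def]
    rfl
  have hht := height_eq_one_of_eq_setOf_mul_mem_span (P := P) (c := c) hb0 fun r => by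
    rw [hz, hcolon]
  obtain ⟨u, s, hs, h⟩ := exists_notMem_mul_eq_of_divisorValuation_le_one _ (hx ⟨P, hprime, hht⟩)
  refine hs (hle ((hcolon _ _).2 ⟨u, IsFractionRing.injective R (FractionRing R) ?_⟩))
  rw [map_mul, map_mul, ← h, mul_div_assoc', mul_div_cancel₀ _ hb']

/-- Multiply powers of elements of `Q \ 𝔭`; the product avoids `𝔭` by primality. The case `𝔭 = ⊥`
gives common denominators, and a height one `𝔭` allows poles elsewhere to be cleared by a unit at
`𝔭`. -/
theorem exists_notMem_forall_divisorValuation_le (𝔭 : Ideal R) [𝔭.IsPrime]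
    (S : Finset (HeightOnePrime R)) (hS : ∀ Q ∈ S, ¬ Q.asIdeal ≤ 𝔭) (N : HeightOnePrime R → ℕ) :
    ∃ s ∉ 𝔭, ∀ Q ∈ S,
      divisorValuation Q (algebraMap R (FractionRing R) s) ≤ WithZero.exp (-(N Q : ℤ)) := by
  classical
  induction S using Finset.induction_on with
  | empty => exact ⟨1, (Ideal.ne_top_iff_one 𝔭).1 (Ideal.IsPrime.ne_top ‹_›), by simp⟩
  | insert P S hPS ih =>
    obtain ⟨s, hs, hsS⟩ := ih fun Q hQ => hS Q (Finset.mem_insert_of_mem hQ)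
    obtain ⟨q, hqP, hq⟩ := SetLike.not_le_iff_exists.1 (hS P (Finset.mem_insert_self P S))
    refine ⟨q ^ N P * s, fun h => ?_, fun Q hQ => ?_⟩
    · exact (Ideal.IsPrime.mem_or_mem ‹_› h).elim
        (fun h => hq (Ideal.IsPrime.mem_of_pow_mem ‹_› _ h)) hs
    · rw [map_mul, map_mul]
      rcases Finset.mem_insert.1 hQ with rfl | hQ
      · refine (mul_le_of_le_one_right' (divisorValuation_algebraMap_le_one Q s)).trans ?_
        rw [map_pow, map_pow, ← nsmul_one (N Q), Nat.smul_one_eq_cast]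
        refine (pow_le_pow_left' (divisorValuation_algebraMap_le_exp_neg_one hqP) _).trans_eq ?_
        rw [← WithZero.exp_nsmul]
        simp
      · exact (mul_le_of_le_one_left' (divisorValuation_algebraMap_le_one Q _)).trans (hsS Q hQ)

/-- A common denominator of all sections of `𝒪(D)`. -/
theorem exists_ne_zero_forall_divisorValuation_mul_le_one (D : WeilDivisor R) :
    ∃ b : R, b ≠ 0 ∧ ∀ x ∈ divisorSections D, ∀ P : HeightOnePrime R,
      divisorValuation P (algebraMap R (FractionRing R) b * x) ≤ 1 := by
  obtain ⟨b, hb, h⟩ := exists_notMem_forall_divisorValuation_le (⊥ : Ideal R) D.support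
    (fun Q _ h => Q.ne_bot (le_bot_iff.1 h)) fun Q => (D Q).toNat
  refine ⟨b, hb, fun x hx P => ?_⟩
  rw [map_mul]
  by_cases hP : P ∈ D.support
  · refine (mul_le_mul' (h P hP) (hx P)).trans ?_
    rw [← WithZero.exp_add, ← WithZero.exp_zero, WithZero.exp_le_exp]
    have := Int.self_le_toNat (D P)
    omega
  · have := hx P
    rw [Finsupp.notMem_support_iff.1 hP, WithZero.exp_zero] at this
    exact mul_le_one' (divisorValuation_algebraMap_le_one P b) this

/-- The sections of `𝒪(D)` localize well at a prime divisor. -/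
theorem exists_notMem_mul_mem_divisorSections {D : WeilDivisor R} (hD : 0 ≤ D)
    (P : HeightOnePrime R) {x : FractionRing R}
    (hx : divisorValuation P x ≤ WithZero.exp (D P)) :
    ∃ s ∉ P.asIdeal, algebraMap R (FractionRing R) s * x ∈ divisorSections D := by
  classical
  have hexp : ∀ Q, (1 : WithZero (Multiplicative ℤ)) ≤ WithZero.exp (D Q) := fun Q => by
    rw [← WithZero.exp_zero, WithZero.exp_le_exp]; exact hD Q
  obtain ⟨a, b, hb, rfl⟩ := IsFractionRing.div_surjective (A := R) x
  have hb0 : b ≠ 0 := nonZeroDivisors.ne_zero hb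
  set x := algebraMap R (FractionRing R) a / algebraMap R (FractionRing R) b with hxdef
  -- Poles of `x` lie only at the finitely many primes containing `b`; `s` cancels all of them
  -- except the one at `P`.
  obtain ⟨s, hs, h⟩ := exists_notMem_forall_divisorValuation_le P.asIdeal
    ((finite_heightOnePrime_mem hb0).toFinset.erase P)
    (fun Q hQ h => Finset.ne_of_mem_erase hQ (HeightOnePrime.eq_of_le h))
    fun Q => (divisorValuation Q x).log.toNat
  refine ⟨s, hs, fun Q => ?_⟩
  rw [map_mul]
  have hs1 := divisorValuation_algebraMap_le_one Q s
  by_cases hQP : Q = P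
  · subst hQP
    exact (mul_le_of_le_one_left' hs1).trans hx
  refine le_trans ?_ (hexp Q)
  by_cases hQ : b ∈ Q.asIdeal
  · refine (mul_le_mul' (h Q (Finset.mem_erase.2 ⟨hQP, by simpa using hQ⟩))
      (WithZero.le_exp_of_log_le (Int.self_le_toNat (divisorValuation Q x).log))).trans ?_
    rw [← WithZero.exp_add, neg_add_cancel, WithZero.exp_zero]
  · refine mul_le_one' hs1 ?_
    rw [hxdef, map_div₀, divisorValuation_algebraMap_eq_one hQ, div_one]
    exact divisorValuation_algebraMap_le_one Q a

end Divisors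

/-! ### Maps on Frobenius roots and functionals on finite modules -/

section Frobenius

theorem FrobRoot.map_pow_smul {R : Type*} [CommRing R] {p e : ℕ} [ExpChar R p] {M N : Type*}
    [AddCommGroup M] [Module R M] [AddCommGroup N] [Module R N] (φ : FrobRoot p e M →ₗ[R] N)
    (r : R) (x : M) : φ (root p e (r ^ p ^ e • x)) = r • φ (root p e x) := by
  rw [← smul_root, _root_.map_smul]

theorem FrobRoot.map_pow_mul {R : Type*} [CommRing R] {p e : ℕ} [ExpChar R p] {N : Type*}
    [AddCommGroup N] [Module R N] (φ : FrobRoot p e R →ₗ[R] N) (r x : R) :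
    φ (root p e (r ^ p ^ e * x)) = r • φ (root p e x) :=
  map_pow_smul φ r x

/-- The composition of a `p^{-e}`-linear map followed by a `p^{-f}`-linear map. -/
def FrobRoot.comp {R : Type*} [CommRing R] {p : ℕ} [ExpChar R p] {e f : ℕ} {L M N : Type*}
    [AddCommGroup L] [Module R L] [AddCommGroup M] [Module R M] [AddCommGroup N] [Module R N]
    (φ : FrobRoot p f M →ₗ[R] N) (ψ : FrobRoot p e L →ₗ[R] M) :
    FrobRoot p (e + f) L →ₗ[R] N where
  toFun x := φ (root p f (ψ (root p e ((root p (e + f)).symm x))))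
  map_add' x y := by simp only [map_add]
  map_smul' r x := by
    obtain ⟨x, rfl⟩ := (root p (e + f)).surjective x
    rw [smul_root, AddEquiv.symm_apply_apply, AddEquiv.symm_apply_apply, pow_add, mul_comm,
      pow_mul, map_pow_smul, map_pow_smul, RingHom.id_apply]

/-- Over a Noetherian domain, torsion-free elements of finite modules are detected by
functionals. -/
theorem exists_linearMap_apply_ne_zero {R M : Type*} [CommRing R] [IsDomain R]
    [IsNoetherianRing R] [AddCommGroup M] [Module R M] [Module.Finite R M] {y : M}
    (hy : ∀ r : R, r ≠ 0 → r • y ≠ 0) : ∃ f : M →ₗ[R] R, f y ≠ 0 := by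
  have : Module.FinitePresentation R M := Module.finitePresentation_of_finite R M
  let K := FractionRing R
  have hne : LocalizedModule.mkLinearMap (nonZeroDivisors R) M y ≠ 0 := fun h => by
    obtain ⟨c, hc⟩ := (IsLocalizedModule.eq_zero_iff (nonZeroDivisors R) _).1 h
    exact hy c (nonZeroDivisors.coe_ne_zero c) hc
  -- Functionals separate points over the fraction field; finite presentation lets a denominator `s`
  -- be cleared to land in `R`.
  obtain ⟨g, hg⟩ := not_forall.1 fun h => hne ((Module.forall_dual_apply_eq_zero_iff K
    (V := LocalizedModule (nonZeroDivisors R) M) _).1 h)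
  obtain ⟨f, s, hfs⟩ := Module.FinitePresentation.exists_lift_of_isLocalizedModule
    (nonZeroDivisors R) (Algebra.linearMap R K)
    (g.restrictScalars R ∘ₗ LocalizedModule.mkLinearMap (nonZeroDivisors R) M)
  refine ⟨f, fun h => ?_⟩
  have h' := LinearMap.congr_fun hfs y
  rw [LinearMap.comp_apply, h, map_zero] at h'
  refine hg ((smul_eq_zero.1 (h'.symm : (s : R) • _ = _)).resolve_left ?_)
  exact nonZeroDivisors.coe_ne_zero s

end Frobenius

/-! ### Twisting by divisors, and existence of nonzero maps -/

section Twist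

variable {R : Type*} [CommRing R] [IsDomain R] [IsNoetherianRing R] [IsIntegrallyClosed R]

theorem coe_toDivisorSections (D : WeilDivisor R) (hD : 0 ≤ D) (r : R) :
    (toDivisorSections D hD r : FractionRing R) = algebraMap R (FractionRing R) r := rfl

/-- A `p^{-e}`-linear map on `R(D)` induces one from `R(D + p^e C)` to `R(C)`. -/
theorem exists_twist {p : ℕ} [ExpChar R p] {e : ℕ} {D C D' : WeilDivisor R} (hD : 0 ≤ D)
    (hC : 0 ≤ C) (hD' : 0 ≤ D') (hle : D' ≤ D + p ^ e • C)
    (φ : FrobRoot p e (divisorSections D) →ₗ[R] R) :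
    ∃ ψ : FrobRoot p e (divisorSections D') →ₗ[R] divisorSections C, ∀ r : R,
      ψ (FrobRoot.root p e (toDivisorSections D' hD' r)) =
        toDivisorSections C hC (φ (FrobRoot.root p e (toDivisorSections D hD r))) := by
  obtain ⟨b, hb, hbD'⟩ := exists_ne_zero_forall_divisorValuation_mul_le_one D'
  have hb' : algebraMap R (FractionRing R) b ≠ 0 := IsFractionRing.to_map_eq_zero_iff.not.mpr hb
  have hmem : ∀ x ∈ divisorSections D',
      LinearMap.lsmul R (FractionRing R) (b ^ p ^ e) x ∈ divisorSections D := fun x hx P => by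
    obtain ⟨k, hk⟩ := Nat.exists_eq_succ_of_ne_zero (pow_pos (expChar_pos R p) e).ne'
    rw [LinearMap.lsmul_apply, Algebra.smul_def, hk, pow_succ,
      map_mul (algebraMap R (FractionRing R)), mul_assoc, map_mul]
    refine (mul_le_one' (divisorValuation_algebraMap_le_one P _) (hbD' x hx P)).trans ?_
    rw [← WithZero.exp_zero, WithZero.exp_le_exp]
    exact hD P
  let g : divisorSections D' →ₗ[R] divisorSections D := LinearMap.restrict _ hmem
  -- The unique extension of `φ` compatible with scalars in the fraction field: `ψ(x) = b⁻¹
  -- φ(b^(p^e) x)`. `hψeq` removes the dependence on `b`.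
  let ψ : FrobRoot p e (divisorSections D') →ₗ[R] FractionRing R :=
    (algebraMap R (FractionRing R) b)⁻¹ • (Algebra.linearMap R (FractionRing R) ∘ₗ φ ∘ₗ
      FrobRoot.map p e g)
  have hψ : ∀ x, ψ (FrobRoot.root p e x) = (algebraMap R (FractionRing R) b)⁻¹ *
      algebraMap R (FractionRing R) (φ (FrobRoot.root p e (g x))) := fun _ => rfl
  have hψeq : ∀ (r : R) (x : divisorSections D') (y : divisorSections D),
      r ^ p ^ e • (x : FractionRing R) = y → algebraMap R (FractionRing R) r *
        ψ (FrobRoot.root p e x) = algebraMap R (FractionRing R) (φ (FrobRoot.root p e y)) := by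
    intro r x y h
    have h1 : r ^ p ^ e • g x = b ^ p ^ e • y := Subtype.ext <| by
      change r ^ p ^ e • (b ^ p ^ e • (x : FractionRing R)) = b ^ p ^ e • (y : FractionRing R)
      rw [smul_comm, h]
    have h2 := congrArg (fun z => φ (FrobRoot.root p e z)) h1
    simp only [FrobRoot.map_pow_smul, smul_eq_mul] at h2
    have h3 := congrArg (algebraMap R (FractionRing R)) h2
    rw [map_mul, map_mul] at h3
    rw [hψ, mul_left_comm, h3, inv_mul_cancel_left₀ hb']
  have hψC : ∀ x, ψ x ∈ divisorSections C := by
    intro x P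
    -- The pole order is bounded one prime at a time: with `n = C(P)` and `s` a unit at `P`, `(s
    -- q^n)^(p^e) x` lies in `R(D)`, so `s q^n ψ(x)` lies in `R`.
    obtain ⟨x, rfl⟩ := (FrobRoot.root p e).surjective x
    obtain ⟨q, hq⟩ := exists_divisorValuation_eq_exp_neg_one P
    obtain ⟨n, hn⟩ := Int.eq_ofNat_of_zero_le (hC P)
    have hqn : divisorValuation P (algebraMap R (FractionRing R) (q ^ n)) =
        WithZero.exp (-(C P)) := by
      rw [map_pow, map_pow, hq, ← WithZero.exp_nsmul, hn]
      simp
    have hx : divisorValuation P ((q ^ n) ^ p ^ e • (x : FractionRing R)) ≤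
        WithZero.exp (D P) := by
      rw [Algebra.smul_def, map_mul, map_pow, map_pow, hqn, ← WithZero.exp_nsmul]
      refine (mul_le_mul_right (x.2 P) _).trans ?_
      rw [← WithZero.exp_add, WithZero.exp_le_exp]
      have := hle P
      simp only [Finsupp.add_apply, Finsupp.smul_apply] at this
      rw [smul_neg]
      omega
    obtain ⟨s, hs, hsx⟩ := exists_notMem_mul_mem_divisorSections hD P hx
    obtain ⟨k, hk⟩ := Nat.exists_eq_succ_of_ne_zero (pow_pos (expChar_pos R p) e).ne'
    have hsx' : (s * q ^ n) ^ p ^ e • (x : FractionRing R) ∈ divisorSections D := by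
      rw [mul_pow, mul_smul]
      nth_rw 1 [hk]
      rw [pow_succ, mul_smul]
      refine Submodule.smul_mem _ _ ?_
      rwa [Algebra.smul_def]
    have h := hψeq (s * q ^ n) x ⟨_, hsx'⟩ rfl
    have hle1 := divisorValuation_algebraMap_le_one P (φ (FrobRoot.root p e ⟨_, hsx'⟩))
    rw [← h, map_mul (algebraMap R (FractionRing R)), map_mul, map_mul,
      divisorValuation_algebraMap_eq_one hs, one_mul, hqn] at hle1
    have h2 := mul_le_mul_right hle1 (WithZero.exp (C P))
    rwa [← mul_assoc, ← WithZero.exp_add, add_neg_cancel, WithZero.exp_zero, one_mul,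
      mul_one] at h2
  refine ⟨ψ.codRestrict (divisorSections C) hψC, fun r => Subtype.ext ?_⟩
  rw [LinearMap.codRestrict_apply, coe_toDivisorSections]
  have h := hψeq 1 (toDivisorSections D' hD' r) (toDivisorSections D hD r)
    (by rw [one_pow, one_smul]; rfl)
  rwa [map_one, one_mul] at h

/-- Nonzero elements of `R` are not killed by all `p^{-e}`-linear maps `R(D) → R`. -/
theorem exists_apply_toDivisorSections_ne_zero {p : ℕ} [ExpChar R p] (hF : IsFFinite R p)
    (e : ℕ) {D : WeilDivisor R} (hD : 0 ≤ D) {y : R} (hy : y ≠ 0) :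
    ∃ φ : FrobRoot p e (divisorSections D) →ₗ[R] R,
      φ (FrobRoot.root p e (toDivisorSections D hD y)) ≠ 0 := by
  have hfin : (iterateFrobenius R p e).Finite := by
    induction e with
    | zero => rw [iterateFrobenius_zero]; exact RingHom.Finite.id R
    | succ e ih => rw [iterateFrobenius_add]; rw [iterateFrobenius_one]; exact ih.comp hF
  have : Module.Finite R (FrobRoot p e R) := hfin
  -- Multiplication by `b` sends `R(D)` into `R`, which reduces the claim to functionals on the
  -- finite module `R^{1/p^e}`.
  obtain ⟨b, hb, hbD⟩ := exists_ne_zero_forall_divisorValuation_mul_le_one D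
  choose g hg using fun x : divisorSections D =>
    exists_algebraMap_eq_of_divisorValuation_le_one (hbD x x.2)
  have hinj := IsFractionRing.injective R (FractionRing R)
  let G : divisorSections D →ₗ[R] R :=
    { toFun := g
      map_add' := fun x y => hinj <| by
        rw [map_add, hg, hg, hg, Submodule.coe_add, mul_add]
      map_smul' := fun r x => hinj <| by
        rw [RingHom.id_apply, smul_eq_mul, map_mul, hg, hg, Submodule.coe_smul, Algebra.smul_def,
          mul_left_comm] }
  have hG : G (toDivisorSections D hD y) = b * y := hinj <| by
    rw [map_mul]; exact hg _
  obtain ⟨f, hf⟩ := exists_linearMap_apply_ne_zero (R := R) (M := FrobRoot p e R)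
    (y := FrobRoot.root p e (b * y)) fun r hr h => by
      rw [FrobRoot.smul_root, EmbeddingLike.map_eq_zero_iff, smul_eq_mul] at h
      exact mul_ne_zero (pow_ne_zero _ hr) (mul_ne_zero hb hy) h
  refine ⟨f ∘ₗ FrobRoot.map p e G, ?_⟩
  change f (FrobRoot.root p e (G (toDivisorSections D hD y))) ≠ 0
  rwa [hG]

end Twist

/-! ### Round-ups under composition -/

theorem ceilDivisor_add_le {R : Type*} [CommRing R] (p e f : ℕ) (Δ : QDivisor R) :
    ceilDivisor p (e + f) Δ ≤ ceilDivisor p e Δ + p ^ e • ceilDivisor p f Δ := by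
  intro P
  simp only [ceilDivisor, QDivisor.ceil, Finsupp.mapRange_apply, Finsupp.smul_apply,
    Finsupp.add_apply, smul_eq_mul, nsmul_eq_mul]
  -- The right side is an integer, so only the unrounded `(p^(e+f) - 1) Δ(P)` has to be bounded.
  rw [Int.ceil_le]
  push_cast
  have h1 := Int.le_ceil (((p : ℚ) ^ e - 1) * Δ P)
  have h2 := mul_le_mul_of_nonneg_left (Int.le_ceil (((p : ℚ) ^ f - 1) * Δ P))
    (by positivity : (0 : ℚ) ≤ (p : ℚ) ^ e)
  rw [pow_add]
  linarith

theorem pow_mul_mem_idealPower {R : Type*} [CommRing R] (p : ℕ) {𝔞 : Ideal R} {t : ℝ}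
    {e f : ℕ} {u y : R}
    (hu : u ∈ idealPower p 𝔞 t f) (hy : y ∈ idealPower p 𝔞 t e) :
    u ^ p ^ e * y ∈ idealPower p 𝔞 t (e + f) := by
  have h := Ideal.mul_mem_mul (Ideal.pow_mem_pow hu (p ^ e)) hy
  rw [idealPower, idealPower, ← pow_mul, ← pow_add] at h
  refine Ideal.pow_le_pow_right (Nat.ceil_le.2 ?_) h
  push_cast
  have h1 := Nat.le_ceil (t * ((p : ℝ) ^ e - 1))
  have h2 := mul_le_mul_of_nonneg_left (Nat.le_ceil (t * ((p : ℝ) ^ f - 1)))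
    (by positivity : (0 : ℝ) ≤ (p : ℝ) ^ e)
  rw [pow_add]
  linarith

/-! ### Trace ideals -/

section TraceIdeal

variable {R : Type*} [CommRing R] [IsDomain R] [IsNoetherianRing R] [IsIntegrallyClosed R]
  (p : ℕ) [Fact p.Prime] [CharP R p]

/-- The inner map must take values in `R(⌈(p^f - 1)Δ⌉)` before the extended outer map can be
applied; `exists_twist` provides this. -/
theorem comp_mem_range_piMap {e f : ℕ} {Δ : QDivisor R} (hΔ : 0 ≤ Δ)
    {φ : FrobRoot p f R →ₗ[R] R} (hφ : φ ∈ LinearMap.range (piMap p f Δ hΔ))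
    {ψ : FrobRoot p e R →ₗ[R] R} (hψ : ψ ∈ LinearMap.range (piMap p e Δ hΔ)) :
    FrobRoot.comp φ ψ ∈ LinearMap.range (piMap p (e + f) Δ hΔ) := by
  obtain ⟨φ, rfl⟩ := hφ
  obtain ⟨ψ, rfl⟩ := hψ
  obtain ⟨θ, hθ⟩ := exists_twist (ceilDivisor_nonneg p e hΔ) (ceilDivisor_nonneg p f hΔ)
    (ceilDivisor_nonneg p (e + f) hΔ) (ceilDivisor_add_le p e f Δ) ψ
  refine ⟨FrobRoot.comp φ θ, LinearMap.ext fun x => ?_⟩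
  obtain ⟨x, rfl⟩ := (FrobRoot.root p (e + f)).surjective x
  exact congrArg (fun z => φ (FrobRoot.root p f z)) (hθ x)

/-- The ideal generated by all `φ((𝔞^⌈t(p^e - 1)⌉ J)^{1/p^e})` with `φ` in the image of
`π_{Δ,e}`. -/
def traceIdeal (Δ : QDivisor R) (hΔ : 0 ≤ Δ) (𝔞 : Ideal R) (t : ℝ) (e : ℕ) (J : Ideal R) :
    Ideal R :=
  Ideal.span {z | ∃ φ ∈ LinearMap.range (piMap p e Δ hΔ), ∃ x ∈ idealPower p 𝔞 t e * J,
    z = φ (FrobRoot.root p e x)}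

variable {Δ : QDivisor R} {hΔ : 0 ≤ Δ} {𝔞 : Ideal R} {t : ℝ}

theorem apply_mem_traceIdeal {e : ℕ} {J : Ideal R} {φ : FrobRoot p e R →ₗ[R] R}
    (hφ : φ ∈ LinearMap.range (piMap p e Δ hΔ)) {x : R} (hx : x ∈ idealPower p 𝔞 t e * J) :
    φ (FrobRoot.root p e x) ∈ traceIdeal p Δ hΔ 𝔞 t e J :=
  Ideal.subset_span ⟨φ, hφ, x, hx, rfl⟩

theorem traceIdeal_traceIdeal_le (e f : ℕ) (J : Ideal R) :
    traceIdeal p Δ hΔ 𝔞 t f (traceIdeal p Δ hΔ 𝔞 t e J) ≤ traceIdeal p Δ hΔ 𝔞 t (e + f) J := by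
  refine Ideal.span_le.2 ?_
  rintro _ ⟨φ, hφ, x, hx, rfl⟩
  induction hx using Submodule.mul_induction_on' with
  | add x _ y _ hx hy => rw [map_add, map_add]; exact add_mem hx hy
  | mem_mul_mem u hu z hz =>
    induction hz using Submodule.span_induction generalizing u with
    | zero => simp
    | add x y _ _ hx hy =>
      rw [mul_add, map_add, map_add]; exact add_mem (hx u hu) (hy u hu)
    | smul r x _ hx =>
      rw [smul_eq_mul, ← mul_assoc]; exact hx _ (Ideal.mul_mem_right r _ hu)
    | mem z h =>
      obtain ⟨ψ, hψ, y, hy, rfl⟩ := h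
      -- Move `u` inside `ψ` as `u^(p^e)`, so that only one composite map remains.
      rw [← smul_eq_mul, ← FrobRoot.map_pow_mul]
      refine apply_mem_traceIdeal p (comp_mem_range_piMap p hΔ hφ hψ) ?_
      change u ^ p ^ e * y ∈ _
      induction hy using Submodule.mul_induction_on' with
      | add x _ y _ hx hy => rw [mul_add]; exact add_mem hx hy
      | mem_mul_mem v hv w hw =>
        rw [← mul_assoc]
        exact Ideal.mul_mem_mul (pow_mul_mem_idealPower p hu hv) hw

/-- If `s` lies in `traceIdeal e J`, then `s ^ k` lies in `traceIdeal (e * k) J` for `k ≥ 1`. -/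
theorem pow_mem_traceIdeal {e : ℕ} {J : Ideal R} {s : R}
    (hs : s ∈ traceIdeal p Δ hΔ 𝔞 t e J) (k : ℕ) :
    s ^ (k + 1) ∈ traceIdeal p Δ hΔ 𝔞 t (e * (k + 1)) J := by
  induction k with
  | zero => simpa using hs
  | succ k ih =>
    rw [mul_add_one e (k + 1), add_comm (e * (k + 1)) e]
    refine traceIdeal_traceIdeal_le p e (e * (k + 1)) J ?_
    rw [pow_succ s (k + 1)]
    generalize s ^ (k + 1) = z at ih
    generalize e * (k + 1) = f at ih
    induction ih using Submodule.span_induction with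
    | zero => simp
    | add x y _ _ hx hy => rw [add_mul]; exact add_mem hx hy
    | smul r x _ hx => rw [smul_eq_mul, mul_assoc]; exact Ideal.mul_mem_left _ r hx
    | mem z h =>
      obtain ⟨φ, hφ, x, hx, rfl⟩ := h
      -- Here `s φ(x) = φ(s^(p^f) x)`. The factor `x` supplies the power of `𝔞` at level `f`, and
      -- `s^(p^f)` still lies in the trace ideal at level `e`.
      rw [mul_comm (φ _), ← smul_eq_mul, ← FrobRoot.map_pow_mul, mul_comm (s ^ _) x]
      have hx' : x ∈ idealPower p 𝔞 t f := Ideal.mul_le_left hx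
      have hs' : s ^ p ^ f ∈ traceIdeal p Δ hΔ 𝔞 t e J :=
        Ideal.pow_mem_of_mem _ hs _ (pow_pos (Fact.out : p.Prime).pos f)
      exact apply_mem_traceIdeal p hφ (Ideal.mul_mem_mul hx' hs')

theorem traceIdeal_le_radical {e m : ℕ} (hm : m ≠ 0) (hem : e ∣ m) (J : Ideal R) :
    traceIdeal p Δ hΔ 𝔞 t e J ≤ (traceIdeal p Δ hΔ 𝔞 t m J).radical := fun s hs => by
  obtain ⟨k, rfl⟩ := hem
  obtain ⟨k, rfl⟩ := Nat.exists_eq_succ_of_ne_zero (right_ne_zero_of_mul hm)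
  exact ⟨k + 1, pow_mem_traceIdeal p hs k⟩

theorem exists_traceIdeal_eq_top {J : Ideal R}
    (h : ⨆ e : ℕ, traceIdeal p Δ hΔ 𝔞 t (e + 1) J = ⊤) :
    ∃ m, 0 < m ∧ traceIdeal p Δ hΔ 𝔞 t m J = ⊤ := by
  obtain ⟨S, hS⟩ := Submodule.mem_iSup_iff_exists_finset.1 ((Ideal.eq_top_iff_one _).1 h)
  -- The product of the finitely many levels involved is a common multiple, so all their trace
  -- ideals lie in one radical.
  refine ⟨∏ e ∈ S, (e + 1), Finset.prod_pos fun e _ => e.succ_pos, ?_⟩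
  rw [← Ideal.radical_eq_top, Ideal.eq_top_iff_one]
  refine SetLike.le_def.1 (iSup₂_le fun e he => ?_) hS
  exact traceIdeal_le_radical p (Finset.prod_pos fun e _ => e.succ_pos).ne'
    (Finset.dvd_prod_of_mem _ he) J

theorem isUniformlyCompatible_iSup_traceIdeal (J : Ideal R) :
    IsUniformlyCompatible p Δ hΔ 𝔞 t (⨆ e : ℕ, traceIdeal p Δ hΔ 𝔞 t (e + 1) J) := by
  intro f φ hφ x hx
  rw [Ideal.mul_iSup] at hx
  induction hx using Submodule.iSup_induction' with
  | zero => simp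
  | add x y _ _ hx hy => rw [map_add, map_add]; exact add_mem hx hy
  | mem e x hx =>
    -- Level `(e + 1) + f` is still positive, even for `f = 0`, and so occurs in the supremum with
    -- index `e + f`.
    refine Ideal.mem_iSup_of_mem (e + f) ?_
    rw [add_right_comm]
    exact traceIdeal_traceIdeal_le p (e + 1) f J (apply_mem_traceIdeal p hφ hx)

theorem traceIdeal_ne_bot (hF : IsFFinite R p) (h𝔞 : 𝔞 ≠ ⊥) (e : ℕ) {J : Ideal R} (hJ : J ≠ ⊥) :
    traceIdeal p Δ hΔ 𝔞 t e J ≠ ⊥ := by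
  have hne : idealPower p 𝔞 t e * J ≠ ⊥ := mul_ne_zero (pow_ne_zero _ h𝔞) hJ
  obtain ⟨y, hy, hy0⟩ := (Submodule.ne_bot_iff _).1 hne
  obtain ⟨φ, hφ⟩ := exists_apply_toDivisorSections_ne_zero hF e (ceilDivisor_nonneg p e hΔ) hy0
  exact (Submodule.ne_bot_iff _).2
    ⟨_, apply_mem_traceIdeal p (LinearMap.mem_range_self (piMap p e Δ hΔ) φ) hy, hφ⟩

/-- A value `φ(x)` is the value at `1` of `φ` precomposed with multiplication by `x`, and sums of
such maps stay in the module. -/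
theorem exists_mem_mulRootIdeal_apply_eq {e : ℕ} {J : Ideal R} {z : R}
    (hz : z ∈ traceIdeal p Δ hΔ 𝔞 t e J) :
    ∃ φ ∈ mulRootIdeal (LinearMap.range (piMap p e Δ hΔ)) (J * idealPower p 𝔞 t e),
      φ (FrobRoot.root p e 1) = z := by
  induction hz using Submodule.span_induction with
  | zero => exact ⟨0, zero_mem _, rfl⟩
  | add x y _ _ hx hy =>
    obtain ⟨φ, hφ, rfl⟩ := hx
    obtain ⟨ψ, hψ, rfl⟩ := hy
    exact ⟨φ + ψ, add_mem hφ hψ, rfl⟩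
  | smul r x _ hx =>
    obtain ⟨φ, hφ, rfl⟩ := hx
    exact ⟨r • φ, Submodule.smul_mem _ r hφ, rfl⟩
  | mem z h =>
    obtain ⟨φ, hφ, x, hx, rfl⟩ := h
    refine ⟨φ ∘ₗ FrobRoot.mulRoot p e x,
      Submodule.subset_span ⟨φ, hφ, x, by rwa [mul_comm], rfl⟩, ?_⟩
    exact congrArg (fun y => φ (FrobRoot.root p e y)) (mul_one x)

theorem IsUniformlyCompatible.range_le {J : Ideal R} (hJ : IsUniformlyCompatible p Δ hΔ 𝔞 t J)
    {d : R} (hd : d ∈ J) {e : ℕ} {φ : FrobRoot p e R →ₗ[R] R}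
    (hφ : φ ∈ mulRootIdeal (LinearMap.range (piMap p e Δ hΔ))
      (Ideal.span {d} * idealPower p 𝔞 t e)) : LinearMap.range φ ≤ J := by
  rintro _ ⟨x, rfl⟩
  induction hφ using Submodule.span_induction with
  | zero => exact J.zero_mem
  | add φ ψ _ _ h h' => exact add_mem h h'
  | smul r φ _ h => exact J.mul_mem_left r h
  | mem φ h =>
    obtain ⟨ψ, hψ, y, hy, rfl⟩ := h
    refine hJ e ψ hψ (y * (FrobRoot.root p e).symm x) (Ideal.mul_mem_right _ _ ?_)
    rw [mul_comm] at hy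
    exact Ideal.mul_mono_right ((Ideal.span_singleton_le_iff_mem J).2 hd) hy

end TraceIdeal

end FSing

theorem mainTheorem6 {R : Type*} [CommRing R] [IsDomain R] [IsNoetherianRing R]
    [IsIntegrallyClosed R] (p : ℕ) [Fact p.Prime] [CharP R p] (hF : FSing.IsFFinite R p)
    (Δ : FSing.QDivisor R) (hΔ : 0 ≤ Δ) (𝔞 : Ideal R) (h𝔞 : 𝔞 ≠ ⊥) (t : ℝ) (ht : 0 < t) :
    FSing.bigTestIdeal p Δ hΔ 𝔞 t = ⊤ ↔ FSing.IsLocallyStronglyFRegular p Δ hΔ 𝔞 t := by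
  constructor
  · intro h d hd
    have hd' : Ideal.span {d} ≠ ⊥ := by simpa using hd
    have hne : ⨆ e : ℕ, FSing.traceIdeal p Δ hΔ 𝔞 t (e + 1) (Ideal.span {d}) ≠ ⊥ := fun h =>
      FSing.traceIdeal_ne_bot p hF h𝔞 (0 + 1) hd' (iSup_eq_bot.1 h 0)
    have htop := top_le_iff.1 (h.ge.trans
      (sInf_le ⟨hne, FSing.isUniformlyCompatible_iSup_traceIdeal p _⟩))
    obtain ⟨e, he, hetop⟩ := FSing.exists_traceIdeal_eq_top p htop
    obtain ⟨φ, hφ, hφ1⟩ := FSing.exists_mem_mulRootIdeal_apply_eq p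
      (hetop ▸ Submodule.mem_top : (1 : R) ∈ _)
    refine ⟨e, he, φ, hφ, fun r => ⟨r • FSing.FrobRoot.root p e 1, ?_⟩⟩
    rw [map_smul, hφ1, smul_eq_mul, mul_one]
  · intro h
    refine top_le_iff.1 (le_sInf ?_)
    rintro J ⟨hJ0, hJ⟩
    obtain ⟨d, hdJ, hd⟩ := (Submodule.ne_bot_iff J).1 hJ0
    obtain ⟨e, -, φ, hφ, hsurj⟩ := h d hd
    exact (LinearMap.range_eq_top.2 hsurj).ge.trans (hJ.range_le p hdJ hφ)
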